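/- For integers $m\ge 3$ and $c$, let $P(m,c)=\frac{c}{2}\{(m-2)c-(m-4)\}$ be the $c$th $m$-gonal number, where the index $c$ ranges over the positive integers if $m=3$ or $m=4$, and over all integers if $m>4$. For positive integers $t$ and $n$, let $r_{m,t}(n)$ denote the number of representations $n=a+b$ with positive integers $a,b$ (disregarding the order of $a$ and $b$) such that $ab=tP(m,c)$ for some such index $c$. Let $\mathbb{P}$ be the set of prime numbers and $k\mathbb{P}=\{kp: p\in\mathbb{P}\}$. Then for every positive integer $n$: 1. $r_{3,1}(n)=0$ iff $2n^2+1\in \mathbb{P}$; 2. $r_{5,1}(n)=0$ iff $6n^2+1\in \mathbb{P}$; 3. $r_{7,1}(n)=0$ iff $10n^2+9\in \mathbb{P}\cup 9\mathbb{P}$; 4. $r_{13,1}(n)=0$ iff $22n^2+81\in \mathbb{P}\cup 9\mathbb{P}\cup 81\mathbb{P}$; 5. $r_{31,1}(n)=0$ iff $58n^2+729\in \mathbb{P}\cup 9\mathbb{P}\cup 81\mathbb{P}\cup 729\mathbb{P}$; 6. $r_{3,2}(n)=0$ iff $n^2+1\in \mathbb{P}$; 7. $r_{8,2}(n)=0$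 iff $3n^2+8\in \mathbb{P}\cup 4\mathbb{P}\cup 8\mathbb{P}$; 8. $r_{12,2}(n)=0$ iff $5n^2+32\in \mathbb{P}\cup 4\mathbb{P}\cup 16\mathbb{P}\cup 32\mathbb{P}$; 9. $r_{24,2}(n)=0$ iff $11n^2+200\in \mathbb{P}\cup 4\mathbb{P}\cup 8\mathbb{P}\cup 25\mathbb{P}\cup 100\mathbb{P}\cup 200\mathbb{P}$; 10. $r_{60,2}(n)=0$ iff $29n^2+1568\in \mathbb{P}\cup 4\mathbb{P}\cup 16\mathbb{P}\cup 32\mathbb{P}\cup 49\mathbb{P}\cup 196\mathbb{P}\cup 784\mathbb{P}\cup 1568\mathbb{P}$; 11. $r_{3,3}(n)=0$ iff $2n^2+3\in \mathbb{P}\cup 3\mathbb{P}$; 12. $r_{3,5}(n)=0$ iff $2n^2+5\in \mathbb{P}\cup 5\mathbb{P}$; 13. $r_{3,11}(n)=0$ iff $2n^2+11\in \mathbb{P}\cup 11\mathbb{P}$; 14. $r_{3,29}(n)=0$ iff $2n^2+29\in \mathbb{P}\cup 29\mathbb{P}$. -/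

import Mathlib

/-- The `c`th `m`-gonal number `P(m,c) = (c/2) ((m-2)c - (m-4))`, as a rational number. -/
def polygonal (m : ℕ) (c : ℤ) : ℚ :=
  (c : ℚ) / 2 * (((m : ℚ) - 2) * c - ((m : ℚ) - 4))

/-- The admissible indices `c` of the `m`-gonal numbers (`3 ≤ m`): the positive integers
if `m = 3` or `m = 4`, and all integers if `4 < m`. -/
def IsPolygonalIndex (m : ℕ) (c : ℤ) : Prop :=
  4 < m ∨ 0 < c

open Classical in
/-- `r_{m,t}(n)`: the number of representations `n = a + b` of `n` as a sum of two positive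
integers, the order of the summands being disregarded (`a ≤ b`), such that `a b = t P(m,c)`
for some admissible index `c`. -/
noncomputable def polyRepr (m t n : ℕ) : ℕ :=
  ((Finset.HasAntidiagonal.antidiagonal n).filter fun q : ℕ × ℕ =>
    0 < q.1 ∧ 0 < q.2 ∧ q.1 ≤ q.2 ∧
      ∃ c : ℤ, IsPolygonalIndex m c ∧ (q.1 : ℚ) * (q.2 : ℚ) = (t : ℚ) * polygonal m c).card

/-- The set of prime numbers. -/
def primeSet : Set ℕ := {p | p.Prime}

/-- The set `k ℙ = {k p : p prime}`. -/
def scaledPrimes (k : ℕ) : Set ℕ := (fun p => k * p) '' primeSet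

/-! With x = b - a, the condition ab = tP(m,c) becomes n² - x² = 4tP(m,c). Completing the square in
c turns this into A x² + B y² = A n² + B e², where AB is one of 2, 4, 6, 10, 22, 58 (for (m,t) =
(3,2) only when n is even). The solutions with x² = n² are those with ab = 0, so r(n) = 0 means that
the given representation is the only one up to signs.

For these determinants every reduced form is diagonal. If N = A n² + B e² is prime to AB and
gcd(n,e) = 1, then a prime N has one representation (`isUniqueRep_of_prime`). A composite N = uv has
two: u and v divide some s² + AB, hence are values of diagonal forms (`exists_diagonal_rep`), and
these compose in two ways, differing by a sign. When AB = 2p there are two classes, and reduction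
mod p decides which one represents N.

Common factors of N with AB, or of n with e, are divided out (`isUniqueRep_mul_ramified`,
`isUniqueRep_mul_mul`); they produce the sets kℙ. -/

/-! ### Uniqueness of representations by a diagonal form -/

/-- The representation of `A n ^ 2 + B e ^ 2` by the form `A x ^ 2 + B y ^ 2` is unique up to
signs. -/
def IsUniqueRep (A B n e : ℤ) : Prop :=
  ∀ x y : ℤ, A * x ^ 2 + B * y ^ 2 = A * n ^ 2 + B * e ^ 2 → x ^ 2 = n ^ 2

theorem IsUniqueRep.swap {A B n e : ℤ} (hB : B ≠ 0) (h : IsUniqueRep A B n e) :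
    IsUniqueRep B A e n := by
  intro x y hxy
  have h1 := h y x (by linarith)
  rw [h1] at hxy
  exact mul_left_cancel₀ hB (by linarith)

theorem isUniqueRep_comm {A B n e : ℤ} (hA : A ≠ 0) (hB : B ≠ 0) :
    IsUniqueRep A B n e ↔ IsUniqueRep B A e n :=
  ⟨fun h => h.swap hB, fun h => h.swap hA⟩

/-- A prime has at most one representation by a diagonal form of discriminant below `-4`. -/
theorem isUniqueRep_of_prime {A B n e N : ℤ} (hN : N = A * n ^ 2 + B * e ^ 2)
    (hcop : IsCoprime N (A * B)) (hAB : 2 ≤ A * B) (hp : Prime N) : IsUniqueRep A B n e := by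
  have key : ∀ x y : ℤ, A * x ^ 2 + B * y ^ 2 = N → N ∣ n * y - x * e → x ^ 2 = n ^ 2 := by
    rintro x y hxy ⟨w, hw⟩
    have hid : (A * n * x + B * e * y) ^ 2 + A * B * (n * y - x * e) ^ 2 = N ^ 2 := by
      rw [pow_two N]; nth_rewrite 1 [hN]; rw [← hxy]; ring
    have hN0 : 0 < N ^ 2 := by have := hp.ne_zero; positivity
    -- In the composition identity a nonzero w would contribute AB w² N² ≥ 2N² to N².
    have hw0 : w = 0 := by
      by_contra hne
      have h1 : 1 ≤ w ^ 2 := by have : 0 < w ^ 2 := by positivity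
                                omega
      rw [hw] at hid
      have h2 : 2 ≤ A * B * w ^ 2 := by nlinarith
      nlinarith [sq_nonneg (A * n * x + B * e * y)]
    have h0 : n * y = x * e := by rw [hw0] at hw; linarith
    apply mul_right_cancel₀ hp.ne_zero
    calc x ^ 2 * N = A * x ^ 2 * n ^ 2 + B * (x * e) ^ 2 := by rw [hN]; ring
      _ = n ^ 2 * N := by rw [← h0, ← hxy]; ring
  intro x y hxy
  have hdiv : N ∣ A * ((n * y - x * e) * (n * y + x * e)) := by
    refine ⟨y ^ 2 - e ^ 2, ?_⟩
    rw [hN]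
    linear_combination -e ^ 2 * hxy
  have hA : IsCoprime N A := hcop.of_mul_right_left
  rcases hp.dvd_or_dvd (hA.dvd_of_dvd_mul_left hdiv) with h | h
  · exact key x y (hxy.trans hN.symm) h
  · have := key (-x) y (by rw [hN, ← hxy]; ring) (by rwa [neg_mul, sub_neg_eq_add])
    simpa using this

/-! ### Gauss reduction to diagonal forms -/

/-- If every reduced form of determinant `D` is diagonal, then every positive form of determinant
`D` is equivalent to a diagonal one. -/
theorem exists_diagonal_form {D : ℤ}
    (hD : ∀ a b c : ℤ, 0 < a → 2 * |b| ≤ a → a ≤ c → a * c - b ^ 2 = D → b = 0) (hD0 : 0 < D) :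
    ∀ (m : ℕ) (a b c : ℤ), 0 < a → a.toNat = m → a * c - b ^ 2 = D →
      ∃ A B p q r s : ℤ, 0 < A ∧ A * B = D ∧ p * s - q * r = 1 ∧
        a = A * p ^ 2 + B * r ^ 2 ∧ b = A * p * q + B * r * s ∧ c = A * q ^ 2 + B * s ^ 2 := by
  intro m
  induction m using Nat.strong_induction_on with
  | _ m ih =>
    intro a b c ha hm hdet
    -- Translate b by the multiple of a that brings it to least absolute value.
    obtain ⟨k, hk⟩ : ∃ k : ℤ, 2 * |b + a * k| ≤ a := by
      refine ⟨-((2 * b + a) / (2 * a)), ?_⟩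
      have h1 := Int.emod_add_mul_ediv (2 * b + a) (2 * a)
      have h2 := Int.emod_nonneg (2 * b + a) (by omega : 2 * a ≠ 0)
      have h3 := Int.emod_lt_of_pos (2 * b + a) (by omega : 0 < 2 * a)
      set z := (2 * b + a) / (2 * a)
      have h4 : 2 * |b + a * -z| = |2 * b - 2 * (a * z)| := by
        rw [show 2 * b - 2 * (a * z) = 2 * (b + a * -z) by ring, abs_mul]; simp
      rw [h4, abs_le]
      constructor <;> nlinarith
    set b' := b + a * k with hb'
    set c' := c + 2 * b * k + a * k ^ 2 with hc'
    have hdet' : a * c' - b' ^ 2 = D := by rw [← hdet, hb', hc']; ring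
    suffices h : ∃ A B p q r s : ℤ, 0 < A ∧ A * B = D ∧ p * s - q * r = 1 ∧
        a = A * p ^ 2 + B * r ^ 2 ∧ b' = A * p * q + B * r * s ∧ c' = A * q ^ 2 + B * s ^ 2 by
      obtain ⟨A, B, p, q, r, s, h1, h2, h3, h4, h5, h6⟩ := h
      refine ⟨A, B, p, q - p * k, r, s - r * k, h1, h2, by linear_combination h3, h4, ?_, ?_⟩
      · linear_combination h5 - k * h4
      · linear_combination h6 - 2 * k * h5 + k ^ 2 * h4 - hc' + 2 * k * hb'
    by_cases hac : a ≤ c'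
    · have hb0 := hD a b' c' ha hk hac hdet'
      refine ⟨a, c', 1, 0, 0, 1, ha, ?_, by ring, by ring, by rw [hb0]; ring, by ring⟩
      rw [← hdet', hb0]; ring
    -- The form is not yet reduced: exchanging the outer coefficients gives the smaller leading
    -- coefficient c', and the induction applies.
    · have hc0 : 0 < c' := by
        by_contra hcon
        nlinarith [sq_nonneg b']
      obtain ⟨A, B, p, q, r, s, h1, h2, h3, h4, h5, h6⟩ :=
        ih c'.toNat (by omega) c' (-b') a hc0 rfl (by linear_combination hdet')
      refine ⟨A, B, q, -p, s, -r, h1, h2, by linear_combination h3, h6, ?_, ?_⟩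
      · linear_combination -h5
      · linear_combination h4

/-- A divisor of `s ^ 2 + D` is properly represented by a diagonal form of determinant `D`. -/
theorem exists_diagonal_rep {D : ℤ}
    (hD : ∀ a b c : ℤ, 0 < a → 2 * |b| ≤ a → a ≤ c → a * c - b ^ 2 = D → b = 0) (hD0 : 0 < D)
    {u s : ℤ} (hu : 1 < u) (hcop : IsCoprime u D) (hdiv : u ∣ s ^ 2 + D) :
    ∃ A B a b : ℤ, 0 < A ∧ A * B = D ∧ a ≠ 0 ∧ b ≠ 0 ∧ u = A * a ^ 2 + B * b ^ 2 := by
  obtain ⟨c, hc⟩ := hdiv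
  obtain ⟨A, B, p, q, r, s, h1, h2, h3, h4, -, -⟩ :=
    exists_diagonal_form hD hD0 u.toNat u s c (by omega) rfl (by linarith)
  have hnu : ¬ IsUnit u := by
    rw [Int.isUnit_iff]; omega
  refine ⟨A, B, p, r, h1, h2, ?_, ?_, h4⟩
  -- A zero coordinate forces the other to be ±1 by unimodularity, so u would be a coefficient and
  -- divide D, against coprimality.
  · rintro rfl
    have hr : IsUnit r := IsUnit.of_mul_eq_one (-q) (by linarith)
    rcases Int.isUnit_iff.1 hr with rfl | rfl <;>
    · rw [show u = B by linarith] at hcop hnu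
      exact hnu (hcop.isUnit_of_dvd' dvd_rfl ⟨A, by linarith⟩)
  · rintro rfl
    have hr : IsUnit p := IsUnit.of_mul_eq_one s (by linarith)
    rcases Int.isUnit_iff.1 hr with rfl | rfl <;>
    · rw [show u = A by linarith] at hcop hnu
      exact hnu (hcop.isUnit_of_dvd' dvd_rfl ⟨B, by linarith⟩)

theorem exists_dvd_sq_add {A B n e : ℤ} (hne : IsCoprime n e)
    (hcop : IsCoprime (A * n ^ 2 + B * e ^ 2) (A * B)) :
    ∃ s : ℤ, A * n ^ 2 + B * e ^ 2 ∣ s ^ 2 + A * B := by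
  have hA : IsCoprime (A * n ^ 2 + B * e ^ 2) A := hcop.of_mul_right_left
  have hBe : IsCoprime (B * e ^ 2) A := by
    rw [add_comm] at hA
    exact IsCoprime.add_mul_left_left_iff.1 hA
  have heA : IsCoprime e A := by
    have := hBe.of_mul_left_right
    rw [pow_two] at this
    exact this.of_mul_left_left
  have heN : IsCoprime (A * n ^ 2 + B * e ^ 2) e := by
    have h : IsCoprime (A * n ^ 2) e := IsCoprime.mul_left heA.symm hne.pow_left
    rw [show A * n ^ 2 + B * e ^ 2 = A * n ^ 2 + e * (B * e) by ring]
    exact IsCoprime.add_mul_left_left h (B * e)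
  obtain ⟨i, j, hij⟩ := heN
  -- Since j inverts e modulo N, s = A n j satisfies s² ≡ -AB (ej)² ≡ -AB.
  refine ⟨A * n * j, A * j ^ 2 + A * B * i * (1 + j * e), ?_⟩
  linear_combination (-A * B * (1 + j * e)) * hij

theorem not_prime_factor {N : ℕ} (h1 : 1 < N) (h : ¬ N.Prime) :
    ∃ u v : ℕ, 1 < u ∧ 1 < v ∧ N = u * v := by
  obtain ⟨u, hu, h1u, huN⟩ := Nat.exists_dvd_of_not_prime2 (by omega) h
  obtain ⟨v, rfl⟩ := hu
  exact ⟨u, v, by omega, by nlinarith, rfl⟩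

theorem sq_sub_ne_sq_add {x y : ℤ} (hx : x ≠ 0) (hy : y ≠ 0) : (x - y) ^ 2 ≠ (x + y) ^ 2 := by
  intro h
  have : x * y = 0 := by linarith
  simp_all

/-! ### Composition of forms and composite numbers -/

/-- The form `A x ^ 2 + B y ^ 2` represents `N` in two essentially different ways. -/
def HasTwoReps (A B N : ℤ) : Prop :=
  ∃ x y z w : ℤ, A * x ^ 2 + B * y ^ 2 = N ∧ A * z ^ 2 + B * w ^ 2 = N ∧ x ^ 2 ≠ z ^ 2

theorem HasTwoReps.not_isUniqueRep {A B n e : ℤ} (h : HasTwoReps A B (A * n ^ 2 + B * e ^ 2)) :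
    ¬ IsUniqueRep A B n e := by
  obtain ⟨x, y, z, w, h1, h2, h3⟩ := h
  exact fun hu => h3 ((hu x y h1).trans (hu z w h2).symm)

/-- `u` is represented by `A a ^ 2 + B b ^ 2` with nonzero `a` and `b`. -/
def IsRep (A B u : ℤ) : Prop :=
  ∃ a b : ℤ, a ≠ 0 ∧ b ≠ 0 ∧ u = A * a ^ 2 + B * b ^ 2

/-- The square of a class is principal. Changing the sign of one coordinate of a factor gives the
second representation, different because all coordinates are nonzero. -/
theorem IsRep.mul_self {A B u v : ℤ} (hA : A ≠ 0) (hB : B ≠ 0) (hu : IsRep A B u)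
    (hv : IsRep A B v) : HasTwoReps 1 (A * B) (u * v) := by
  obtain ⟨a, b, ha, hb, rfl⟩ := hu
  obtain ⟨c, d, hc, hd, rfl⟩ := hv
  refine ⟨A * a * c - B * b * d, a * d + b * c, A * a * c + B * b * d, a * d - b * c,
    by ring, by ring, sq_sub_ne_sq_add ?_ ?_⟩ <;> positivity

theorem IsRep.mul_principal {A B u v : ℤ} (hB : B ≠ 0) (hu : IsRep A B u)
    (hv : IsRep 1 (A * B) v) : HasTwoReps A B (u * v) := by
  obtain ⟨a, b, ha, hb, rfl⟩ := hu
  obtain ⟨c, d, hc, hd, rfl⟩ := hv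
  refine ⟨a * c - B * b * d, b * c + A * a * d, a * c + B * b * d, b * c - A * a * d,
    by ring, by ring, sq_sub_ne_sq_add ?_ ?_⟩ <;> positivity

/-- Isolates in `hcomp` the only part that depends on the class group; both factors divide the same
s² + AB. -/
theorem isUniqueRep_iff_prime {A B n e : ℤ} {N : ℕ} (hN : (N : ℤ) = A * n ^ 2 + B * e ^ 2)
    (hne : IsCoprime n e) (hcop : IsCoprime (N : ℤ) (A * B)) (h1 : 1 < N) (hAB : 2 ≤ A * B)
    (hcomp : ∀ u v s : ℤ, 1 < u → 1 < v → (N : ℤ) = u * v → IsCoprime u (A * B) →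
      IsCoprime v (A * B) → u ∣ s ^ 2 + A * B → v ∣ s ^ 2 + A * B → HasTwoReps A B N) :
    IsUniqueRep A B n e ↔ N.Prime := by
  constructor
  · intro h
    by_contra hp
    obtain ⟨u, v, hu, hv, huv⟩ := not_prime_factor h1 hp
    obtain ⟨s, hs⟩ := exists_dvd_sq_add hne (hN ▸ hcop)
    have hNuv : (N : ℤ) = u * v := by exact_mod_cast huv
    rw [← hN] at hs
    rw [hNuv] at hcop hs
    refine HasTwoReps.not_isUniqueRep ?_ h
    rw [← hN]
    exact hcomp u v s (by exact_mod_cast hu) (by exact_mod_cast hv) hNuv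
      hcop.of_mul_left_left hcop.of_mul_left_right
      ((dvd_mul_right _ _).trans hs) ((dvd_mul_left _ _).trans hs)
  · intro hp
    exact isUniqueRep_of_prime hN hcop hAB (Nat.prime_iff_prime_int.1 hp)

/-! ### Classes and genera for the determinants 2, 4, 6, 10, 22, 58 -/

/-- The reduced forms of determinant `D` are diagonal. -/
def AllReducedDiagonal (D : ℤ) : Prop :=
  ∀ a b c : ℤ, 0 < a → 2 * |b| ≤ a → a ≤ c → a * c - b ^ 2 = D → b = 0

/-- From a² ≤ ac = D + b² and 4b² ≤ a² follows 3a² ≤ 4D, so a ≤ 8 and |b| ≤ 4 when D ≤ 58: a finite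
check. -/
theorem allReducedDiagonal_of_bounded {D : ℤ} (hD : D ≤ 58)
    (h : ∀ b ∈ Finset.Icc (1 : ℤ) 4, ∀ a ∈ Finset.Icc (2 * b) 8, (D + b ^ 2) % a = 0 →
      (D + b ^ 2) / a < a) : AllReducedDiagonal D := by
  intro a b c ha hb hac hdet
  by_contra hne
  have hb1 : 1 ≤ |b| := Int.one_le_abs hne
  have hsq : |b| ^ 2 = b ^ 2 := sq_abs b
  rw [← hsq] at hdet
  set β := |b|
  have h1 : a * a ≤ D + β ^ 2 := by nlinarith
  have hb4 : β ≤ 4 := by nlinarith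
  have ha8 : a ≤ 8 := by nlinarith
  have hmul : D + β ^ 2 = a * c := by linarith
  have := h β (Finset.mem_Icc.2 ⟨hb1, hb4⟩) a (Finset.mem_Icc.2 ⟨hb, ha8⟩)
    (by rw [hmul]; simp)
  rw [hmul, Int.mul_ediv_cancel_left _ ha.ne'] at this
  omega

theorem allReducedDiagonal_of_mem {D : ℤ} (hD : D ∈ ({2, 4, 6, 10, 22, 58} : Finset ℤ)) :
    AllReducedDiagonal D := by
  refine allReducedDiagonal_of_bounded ?_ ?_
  · revert D; decide
  · revert D; decide

theorem HasTwoReps.swap {A B N : ℤ} (hA : A ≠ 0) (h : HasTwoReps A B N) :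
    HasTwoReps B A N := by
  obtain ⟨x, y, z, w, h1, h2, h3⟩ := h
  refine ⟨y, x, w, z, by linarith, by linarith, fun h => h3 ?_⟩
  rw [h] at h1
  exact mul_left_cancel₀ hA (by linarith)

/-- For `D = 2, 4` the principal form is the only one in its genus and represents every
coprime divisor of `s ^ 2 + D`. -/
theorem isRep_principal {D u s : ℤ} (hD : D = 2 ∨ D = 4) (hu : 1 < u) (hcop : IsCoprime u D)
    (hdiv : u ∣ s ^ 2 + D) : IsRep 1 D u := by
  obtain ⟨A, B, a, b, hA, hAB, ha, hb, rfl⟩ := exists_diagonal_rep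
    (allReducedDiagonal_of_mem (by rcases hD with rfl | rfl <;> decide)) (by omega) hu hcop hdiv
  have hAD : A ≤ D := Int.le_of_dvd (by omega) ⟨B, hAB.symm⟩
  rcases hD with rfl | rfl
  · interval_cases A
    · exact ⟨a, b, ha, hb, by rw [← hAB]; ring⟩
    · exact ⟨b, a, hb, ha, by rw [show B = 1 by omega]; ring⟩
  · interval_cases A
    · exact ⟨a, b, ha, hb, by rw [← hAB]; ring⟩
    -- The imprimitive form 2x² + 2y² takes only even values.
    · obtain rfl : B = 2 := by omega
      exfalso
      have : IsUnit (2 : ℤ) := hcop.isUnit_of_dvd' ⟨a ^ 2 + b ^ 2, by ring⟩ ⟨2, by norm_num⟩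
      rw [Int.isUnit_iff] at this
      omega
    · omega
    · exact ⟨b, a, hb, ha, by rw [show B = 1 by omega]; ring⟩

theorem three_le_of_mem {p : ℤ} (hp : p ∈ ({3, 5, 11, 29} : Finset ℤ)) : 3 ≤ p := by
  revert p; decide

theorem two_mul_mem {p : ℤ} (hp : p ∈ ({3, 5, 11, 29} : Finset ℤ)) :
    2 * p ∈ ({2, 4, 6, 10, 22, 58} : Finset ℤ) := by
  revert p; decide

theorem two_le_of_mem {D : ℤ} (hD : D ∈ ({2, 4, 6, 10, 22, 58} : Finset ℤ)) : 2 ≤ D := by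
  revert D; decide

theorem isRep_or_isRep {p u s : ℤ} (hp : p ∈ ({3, 5, 11, 29} : Finset ℤ)) (hu : 1 < u)
    (hcop : IsCoprime u (2 * p)) (hdiv : u ∣ s ^ 2 + 2 * p) :
    IsRep 1 (2 * p) u ∨ IsRep 2 p u := by
  have hp3 := three_le_of_mem hp
  obtain ⟨A, B, a, b, hA, hAB, ha, hb, rfl⟩ := exists_diagonal_rep
    (allReducedDiagonal_of_mem (two_mul_mem hp)) (by omega) hu hcop hdiv
  have hcases : A = 1 ∨ A = 2 ∨ B = 1 ∨ B = 2 := by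
    clear hcop hdiv
    have hAD : A ≤ 2 * p := Int.le_of_dvd (by omega) ⟨B, hAB.symm⟩
    simp only [Finset.mem_insert, Finset.mem_singleton] at hp
    rcases hp with rfl | rfl | rfl | rfl <;> interval_cases A <;> omega
  rcases hcases with rfl | rfl | rfl | rfl
  · exact Or.inl ⟨a, b, ha, hb, by rw [← hAB]; ring⟩
  · exact Or.inr ⟨a, b, ha, hb, by rw [show B = p by omega]⟩
  · exact Or.inl ⟨b, a, hb, ha, by rw [← hAB]; ring⟩
  · exact Or.inr ⟨b, a, hb, ha, by rw [show A = p by omega]; ring⟩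

/-- 2 is a quadratic nonresidue modulo each of these primes. -/
theorem dvd_of_sq_eq_two_mul_sq {p x z : ℤ} (hp : p ∈ ({3, 5, 11, 29} : Finset ℤ))
    (h : p ∣ x ^ 2 - 2 * z ^ 2) : p ∣ x := by
  have main : ∀ q : ℕ, (∀ x z : ZMod q, x ^ 2 - 2 * z ^ 2 = 0 → x = 0) →
      (q : ℤ) ∣ x ^ 2 - 2 * z ^ 2 → (q : ℤ) ∣ x := by
    intro q hq hd
    rw [← ZMod.intCast_zmod_eq_zero_iff_dvd] at hd ⊢
    exact hq x z (by exact_mod_cast hd)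
  simp only [Finset.mem_insert, Finset.mem_singleton] at hp
  rcases hp with rfl | rfl | rfl | rfl
  · exact main 3 (by decide) h
  · exact main 5 (by decide) h
  · exact main 11 (by decide) h
  · exact main 29 (by decide +kernel) h

/-- The two diagonal genera of determinant `2 p` represent different numbers. -/
theorem not_both_genera {p N x y z w : ℤ} (hp : p ∈ ({3, 5, 11, 29} : Finset ℤ))
    (hcop : IsCoprime N (2 * p)) (h1 : 1 * x ^ 2 + 2 * p * y ^ 2 = N)
    (h2 : 2 * z ^ 2 + p * w ^ 2 = N) : False := by
  have hx : p ∣ x := dvd_of_sq_eq_two_mul_sq (z := z) hp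
    ⟨w ^ 2 - 2 * y ^ 2, by linear_combination h1 - h2⟩
  have hN : p ∣ N := by
    rw [← h1]
    exact dvd_add ((hx.trans (dvd_pow_self x two_ne_zero)).mul_left 1) ⟨2 * y ^ 2, by ring⟩
  have := hcop.isUnit_of_dvd' hN (dvd_mul_left p 2)
  rw [Int.isUnit_iff] at this
  revert p; simp only [Finset.mem_insert, Finset.mem_singleton]; omega

/-- The multiplication table of a class group of order two: equal classes compose to the principal
form, different ones to 2x² + py². -/
theorem hasTwoReps_or {p N u v s : ℤ} (hp : p ∈ ({3, 5, 11, 29} : Finset ℤ)) (hu : 1 < u)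
    (hv : 1 < v) (hN : N = u * v) (hcu : IsCoprime u (2 * p)) (hcv : IsCoprime v (2 * p))
    (hdu : u ∣ s ^ 2 + 2 * p) (hdv : v ∣ s ^ 2 + 2 * p) :
    HasTwoReps 1 (2 * p) N ∨ HasTwoReps 2 p N := by
  have hp0 : p ≠ 0 := by have := three_le_of_mem hp; omega
  rcases isRep_or_isRep hp hu hcu hdu with h | h <;>
    rcases isRep_or_isRep hp hv hcv hdv with h' | h'
  · left; simpa [hN] using h.mul_self one_ne_zero (by simpa using hp0) h'
  · right; rw [hN, mul_comm]; exact h'.mul_principal hp0 h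
  · right; rw [hN]; exact h.mul_principal hp0 h'
  · left; rw [hN]; exact h.mul_self two_ne_zero hp0 h'

theorem isUniqueRep_principal_iff {D n e : ℤ} {N : ℕ}
    (hD : D ∈ ({2, 4, 6, 10, 22, 58} : Finset ℤ)) (hN : (N : ℤ) = D * n ^ 2 + e ^ 2)
    (hne : IsCoprime n e) (hcop : IsCoprime (N : ℤ) D) (h1 : 1 < N) :
    IsUniqueRep D 1 n e ↔ N.Prime := by
  have hD2 := two_le_of_mem hD
  have hD0 : D ≠ 0 := by omega
  have hDD : 2 ≤ D * 1 := by omega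
  refine isUniqueRep_iff_prime (by rw [hN]; ring) hne (by simpa using hcop) h1 hDD ?_
  intro u v s hu hv huv hcu hcv hdu hdv
  rw [mul_one] at hcu hcv hdu hdv
  refine HasTwoReps.swap one_ne_zero ?_
  by_cases hD24 : D = 2 ∨ D = 4
  · rw [huv]
    simpa using (isRep_principal hD24 hu hcu hdu).mul_self one_ne_zero hD0
      (isRep_principal hD24 hv hcv hdv)
  · obtain ⟨p, hp, rfl⟩ : ∃ p ∈ ({3, 5, 11, 29} : Finset ℤ), D = 2 * p := by
      simp only [Finset.mem_insert, Finset.mem_singleton] at hD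
      rcases hD with rfl | rfl | rfl | rfl | rfl | rfl
      · simp at hD24
      · simp at hD24
      · exact ⟨3, by decide, rfl⟩
      · exact ⟨5, by decide, rfl⟩
      · exact ⟨11, by decide, rfl⟩
      · exact ⟨29, by decide, rfl⟩
    rcases hasTwoReps_or hp hu hv huv hcu hcv hdu hdv with h | ⟨x, y, z, w, h, -, -⟩
    · exact h
    · exact (not_both_genera hp hcop (by rw [hN]; ring : 1 * e ^ 2 + 2 * p * n ^ 2 = (N : ℤ))
        h).elim

theorem isUniqueRep_two_iff {p n e : ℤ} {N : ℕ} (hp : p ∈ ({3, 5, 11, 29} : Finset ℤ))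
    (hN : (N : ℤ) = 2 * n ^ 2 + p * e ^ 2) (hne : IsCoprime n e)
    (hcop : IsCoprime (N : ℤ) (2 * p)) (h1 : 1 < N) :
    IsUniqueRep 2 p n e ↔ N.Prime := by
  refine isUniqueRep_iff_prime hN hne hcop h1
    (by have := three_le_of_mem hp; omega) ?_
  intro u v s hu hv huv hcu hcv hdu hdv
  rcases hasTwoReps_or hp hu hv huv hcu hcv hdu hdv with ⟨x, y, z, w, h, -, -⟩ | h
  · exact (not_both_genera hp hcop h hN.symm).elim
  · exact h

/-! ### Dividing out common factors -/

/-- A prime q dividing the second coefficient and the value must divide x; cancelling q moves it to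
the first coefficient. -/
theorem isUniqueRep_mul_ramified {A B n e q : ℤ} (hq : Prime q) (hA : ¬ q ∣ A) :
    IsUniqueRep A (B * q) (q * n) e ↔ IsUniqueRep (A * q) B n e := by
  have hq0 := hq.ne_zero
  constructor
  · intro h x y hxy
    have := h (q * x) y (by linear_combination q * hxy)
    rw [mul_pow, mul_pow] at this
    exact mul_left_cancel₀ (pow_ne_zero 2 hq0) this
  · intro h x y hxy
    have hx : q ∣ A * x ^ 2 := ⟨A * q * n ^ 2 + B * e ^ 2 - B * y ^ 2, by linear_combination hxy⟩
    obtain ⟨z, rfl⟩ := hq.dvd_of_dvd_pow ((hq.dvd_or_dvd hx).resolve_left hA)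
    rw [mul_pow, mul_pow, h z y (mul_left_cancel₀ hq0 (by linear_combination hxy))]

/-- Requiring divisibility by q², not q, also admits q = 2 for px² + 2y², which has nontrivial zeros
modulo 2. -/
theorem isUniqueRep_mul_mul {A B n e q : ℤ} (hq : q ≠ 0)
    (h : ∀ x y : ℤ, q ^ 2 ∣ A * x ^ 2 + B * y ^ 2 → q ∣ x ∧ q ∣ y) :
    IsUniqueRep A B (q * n) (q * e) ↔ IsUniqueRep A B n e := by
  constructor
  · intro hu x y hxy
    have := hu (q * x) (q * y) (by linear_combination q ^ 2 * hxy)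
    rw [mul_pow, mul_pow] at this
    exact mul_left_cancel₀ (pow_ne_zero 2 hq) this
  · intro hu x y hxy
    obtain ⟨⟨z, rfl⟩, ⟨w, rfl⟩⟩ := h x y ⟨A * n ^ 2 + B * e ^ 2, by linear_combination hxy⟩
    rw [mul_pow, mul_pow,
      hu z w (mul_left_cancel₀ (pow_ne_zero 2 hq) (by linear_combination hxy))]

/-- The form `A x ^ 2 + B y ^ 2` is anisotropic modulo `q`. -/
def AnisotropicMod (A B : ℤ) (q : ℕ) : Prop :=
  ∀ x y : ℤ, (q : ℤ) ∣ A * x ^ 2 + B * y ^ 2 → (q : ℤ) ∣ x ∧ (q : ℤ) ∣ y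

theorem anisotropicMod_of_zmod {A B : ℤ} {q : ℕ}
    (h : ∀ x y : ZMod q, (A : ZMod q) * x ^ 2 + (B : ZMod q) * y ^ 2 = 0 → x = 0 ∧ y = 0) :
    AnisotropicMod A B q := by
  intro x y hxy
  rw [← ZMod.intCast_zmod_eq_zero_iff_dvd] at hxy
  rw [← ZMod.intCast_zmod_eq_zero_iff_dvd, ← ZMod.intCast_zmod_eq_zero_iff_dvd]
  exact h x y (by exact_mod_cast hxy)

theorem AnisotropicMod.isUniqueRep_mul_mul {A B n e : ℤ} {q : ℕ} (hq : q ≠ 0)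
    (h : AnisotropicMod A B q) :
    IsUniqueRep A B (q * n) (q * e) ↔ IsUniqueRep A B n e :=
  _root_.isUniqueRep_mul_mul (by exact_mod_cast hq)
    fun x y hxy => h x y ((dvd_pow_self _ two_ne_zero).trans hxy)

theorem mem_scaledPrimes {N k : ℕ} : N ∈ scaledPrimes k ↔ ∃ p, p.Prime ∧ k * p = N := Iff.rfl

theorem mem_scaledPrimes_one {N : ℕ} : N ∈ scaledPrimes 1 ↔ N.Prime := by
  simp [mem_scaledPrimes]

theorem mem_primeSet_iff {N : ℕ} : N ∈ primeSet ↔ N ∈ scaledPrimes 1 := by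
  rw [mem_scaledPrimes_one]; rfl

theorem dvd_of_mem_scaledPrimes {N k : ℕ} (h : N ∈ scaledPrimes k) : k ∣ N := by
  obtain ⟨p, -, rfl⟩ := mem_scaledPrimes.1 h
  exact dvd_mul_right _ _

theorem mul_mem_scaledPrimes_mul {a k M : ℕ} (ha : 0 < a) :
    a * M ∈ scaledPrimes (a * k) ↔ M ∈ scaledPrimes k := by
  simp only [mem_scaledPrimes, mul_assoc, Nat.mul_right_inj ha.ne']

theorem sq_mul_notMem_scaledPrimes {q k M : ℕ} (hq : 1 < q) (hqk : q.Coprime k) :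
    q ^ 2 * M ∉ scaledPrimes k := by
  rw [mem_scaledPrimes]
  rintro ⟨p, hp, h⟩
  have h1 : q ^ 2 ∣ p := (Nat.Coprime.pow_left 2 hqk).dvd_of_dvd_mul_left ⟨M, h⟩
  have h3 : IsUnit q := hp.prime.squarefree q (by rwa [← pow_two])
  rw [Nat.isUnit_iff] at h3
  omega

/-! ### From polygonal numbers to quadratic forms -/

/-- With k = m - 2 the expression is 2P(m,c); its sign gives |x| ≤ n below. -/
theorem mul_self_pred_nonneg {k c : ℤ} (h : 2 ≤ k ∨ (1 ≤ k ∧ 0 < c)) :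
    0 ≤ c * (k * c - (k - 2)) := by
  rcases lt_or_ge 0 c with hc | hc
  · have hk : 1 ≤ k := by omega
    have : 0 ≤ k * (c - 1) := mul_nonneg (by omega) (by omega)
    exact mul_nonneg hc.le (by linarith)
  · have hk : 2 ≤ k := by omega
    have : k * c ≤ 0 := mul_nonpos_of_nonneg_of_nonpos (by omega) hc
    exact mul_nonneg_of_nonpos_of_nonpos hc (by linarith)

open Classical in
/-- With `a + b = n` and `b - a = x` the condition `a b = t P(m, c)` reads
`n ^ 2 = x ^ 2 + 4 t P(m, c)`. -/
theorem polyRepr_eq_zero_iff {m t n : ℕ} (hm : 3 ≤ m) :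
    polyRepr m t n = 0 ↔ ∀ x c : ℤ, IsPolygonalIndex m c →
      (n : ℤ) ^ 2 = x ^ 2 + 2 * t * (c * ((m - 2) * c - (m - 4))) → x ^ 2 = (n : ℤ) ^ 2 := by
  unfold polyRepr
  rw [Finset.card_eq_zero, Finset.filter_eq_empty_iff]
  constructor
  · intro h x c hc hx
    by_contra hne
    have hP : 0 ≤ c * (((m : ℤ) - 2) * c - (m - 4)) := by
      have := mul_self_pred_nonneg (k := (m : ℤ) - 2) (c := c)
        (by unfold IsPolygonalIndex at hc; omega)
      convert this using 3
      ring
    obtain ⟨w, hw⟩ : (2 : ℤ) ∣ c * (((m : ℤ) - 2) * c - (m - 4)) := by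
      obtain ⟨w, hw⟩ := (Int.even_mul_pred_self c).two_dvd
      exact ⟨(m - 2) * w + c, by linear_combination ((m : ℤ) - 2) * hw⟩
    have hle : x ^ 2 < (n : ℤ) ^ 2 := lt_of_le_of_ne (by rw [hx]; nlinarith) hne
    have hlt : x.natAbs < n := by
      have := sq_lt_sq.1 hle
      rw [Int.abs_eq_natAbs, Int.abs_eq_natAbs] at this
      omega
    rw [← Int.natAbs_sq x] at hx
    set y := x.natAbs
    -- Parity makes a = (n - |x|)/2 an integer; it is positive because x² ≠ n².
    have hpar : 2 ∣ n - y := by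
      have h4 : Even ((n : ℤ) ^ 2 - (y : ℤ) ^ 2) := ⟨2 * t * w, by rw [hx, hw]; ring⟩
      have h5 : Even ((n : ℤ) - y) := by
        rw [Int.even_sub, Int.even_pow' two_ne_zero, Int.even_pow' two_ne_zero] at h4
        rwa [Int.even_sub]
      have := h5.two_dvd
      omega
    obtain ⟨a, ha⟩ := hpar
    obtain rfl : n = y + 2 * a := by omega
    refine @h (a, a + y) (by simp; omega) ⟨by omega, by simp; omega, by simp, c, hc, ?_⟩
    have hx' := congrArg (Int.cast : ℤ → ℚ) hx
    unfold polygonal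
    push_cast at hx' ⊢
    linear_combination hx' / 4
  · rintro h ⟨a, b⟩ hab ⟨ha, hb, -, c, hc, hP⟩
    rw [Finset.HasAntidiagonal.mem_antidiagonal] at hab
    simp only at hab ha hb hP
    subst hab
    unfold polygonal at hP
    have := h (b - a) c hc (by
      apply Int.cast_injective (α := ℚ)
      push_cast
      linear_combination 4 * hP)
    push_cast at this
    have ha' : (0 : ℤ) < a := by exact_mod_cast ha
    have hb' : (0 : ℤ) < b := by exact_mod_cast hb
    nlinarith [mul_pos ha' hb']

theorem two_dvd_sub_of_sq {a b : ℤ} (h : (2 : ℤ) ∣ a ^ 2 - b ^ 2) : (2 : ℤ) ∣ a - b := by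
  rw [← even_iff_two_dvd] at *
  rw [Int.even_sub, Int.even_pow' two_ne_zero, Int.even_pow' two_ne_zero] at h
  rwa [Int.even_sub]

theorem four_dvd_of_two_dvd_sq {a b : ℤ} (h : (2 : ℤ) ∣ a ^ 2 - b ^ 2) :
    (4 : ℤ) ∣ a ^ 2 - b ^ 2 := by
  obtain ⟨w, hw⟩ := two_dvd_sub_of_sq h
  exact ⟨w * (w + b), by linear_combination (a + b + 2 * w) * hw⟩

theorem polyRepr_three_iff {t n : ℕ} (ht : Odd t) :
    polyRepr 3 t n = 0 ↔ IsUniqueRep 2 t n 1 := by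
  rw [polyRepr_eq_zero_iff le_rfl]
  constructor
  · intro h x y hxy
    have hy : Odd y := by
      have h1 : Even ((t : ℤ) * (y ^ 2 - 1)) := ⟨n ^ 2 - x ^ 2, by linear_combination hxy⟩
      have h2 : ¬ Even (t : ℤ) := by
        rw [Int.not_even_iff_odd]; exact_mod_cast ht
      have h3 := (Int.even_mul.1 h1).resolve_left h2
      rw [Int.even_sub_one, Int.not_even_iff_odd] at h3
      exact (Int.odd_pow' two_ne_zero).1 h3
    obtain ⟨c, hc⟩ := hy.natAbs
    rw [← Int.natAbs_sq y, hc] at hxy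
    push_cast at hxy
    -- Index 0 is not admissible for m = 3, but there y² = 1 and x² = n² is immediate.
    rcases Nat.eq_zero_or_pos c with rfl | hc0
    · simpa using hxy
    · refine h x c (Or.inr (by exact_mod_cast hc0)) ?_
      push_cast
      linarith
  · intro h x c _ hx
    refine h x (2 * c + 1) ?_
    push_cast at hx
    linear_combination -2 * hx

/-- Multiplying by 2p completes the square with y = 2pc - (p - 2). Conversely y ≡ ±(p - 2) mod p,
and after a sign change y has this shape; every integer index is allowed since m > 4. -/
theorem polyRepr_one_iff {m p n : ℕ} (hp : p.Prime) (hp2 : p ≠ 2) (hm : m = p + 2) :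
    polyRepr m 1 n = 0 ↔ IsUniqueRep (2 * p) 1 n (p - 2) := by
  have hp3 : 3 ≤ p := by have := hp.two_le; omega
  have hodd := hp.odd_of_ne_two hp2
  subst hm
  rw [polyRepr_eq_zero_iff (by omega)]
  constructor
  · have key : ∀ x y : ℤ, 2 * (p : ℤ) * x ^ 2 + 1 * y ^ 2 = 2 * p * n ^ 2 + 1 * (p - 2) ^ 2 →
        (p : ℤ) ∣ y + (p - 2) → ∃ c : ℤ, y = 2 * p * c - (p - 2) := by
      intro x y hxy hd
      have h2 : (2 : ℤ) ∣ y + (p - 2) := by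
        have := two_dvd_sub_of_sq (a := y) (b := -(p - 2))
          ⟨p * n ^ 2 - p * x ^ 2, by linear_combination hxy⟩
        rwa [sub_neg_eq_add] at this
      have hcop : IsCoprime (2 : ℤ) p := by
        exact_mod_cast Nat.isCoprime_iff_coprime.2 (Nat.coprime_two_left.2 hodd)
      obtain ⟨c, hc⟩ := hcop.mul_dvd h2 hd
      exact ⟨c, by linear_combination hc⟩
    have fin : ∀ x c : ℤ, 2 * (p : ℤ) * x ^ 2 + 1 * (2 * p * c - (p - 2)) ^ 2 =
        2 * p * n ^ 2 + 1 * (p - 2) ^ 2 →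
        (n : ℤ) ^ 2 = x ^ 2 + 2 * (1 : ℕ) *
          (c * ((((p + 2 : ℕ) : ℤ) - 2) * c - (((p + 2 : ℕ) : ℤ) - 4))) := by
      intro x c h
      have hp0 : (2 * p : ℤ) ≠ 0 := by positivity
      apply mul_left_cancel₀ hp0
      push_cast
      linear_combination -h
    intro h x y hxy
    have hdiv : (p : ℤ) ∣ (y + (p - 2)) * (-y + (p - 2)) :=
      ⟨2 * x ^ 2 - 2 * n ^ 2, by linear_combination -hxy⟩
    rcases (Nat.prime_iff_prime_int.1 hp).dvd_or_dvd hdiv with hd | hd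
    · obtain ⟨c, rfl⟩ := key x y hxy hd
      exact h x c (Or.inl (by omega)) (fin x c hxy)
    · have hxy' : 2 * (p : ℤ) * x ^ 2 + 1 * (-y) ^ 2 = 2 * p * n ^ 2 + 1 * (p - 2) ^ 2 := by
        rw [neg_sq]; exact hxy
      obtain ⟨c, hc⟩ := key x (-y) hxy' hd
      rw [hc] at hxy'
      exact h x c (Or.inl (by omega)) (fin x c hxy')
  · intro h x c _ hx
    refine h x (2 * p * c - (p - 2)) ?_
    push_cast at hx
    linear_combination -2 * p * hx

theorem polyRepr_two_iff {m p n : ℕ} (hp : p.Prime) (hp2 : p ≠ 2) (hm : m = 2 * p + 2) :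
    polyRepr m 2 n = 0 ↔ IsUniqueRep p 2 n (p - 1) := by
  have hp3 : 3 ≤ p := by have := hp.two_le; omega
  have hodd := hp.odd_of_ne_two hp2
  have hcop : IsCoprime (2 : ℤ) p := by
    exact_mod_cast Nat.isCoprime_iff_coprime.2 (Nat.coprime_two_left.2 hodd)
  subst hm
  rw [polyRepr_eq_zero_iff (by omega)]
  constructor
  · have key : ∀ x y : ℤ, (p : ℤ) * x ^ 2 + 2 * y ^ 2 = p * n ^ 2 + 2 * (p - 1) ^ 2 →
        (p : ℤ) ∣ y + (p - 1) → ∃ c : ℤ, y = 2 * p * c - (p - 1) := by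
      intro x y hxy hd
      have h2 : (2 : ℤ) ∣ (n : ℤ) ^ 2 - x ^ 2 :=
        hcop.dvd_of_dvd_mul_left ⟨y ^ 2 - (p - 1) ^ 2, by linear_combination -hxy⟩
      -- The factor 2 before y² hides the parity of y; it is recovered because an even difference of
      -- squares is divisible by 4.
      obtain ⟨w, hw⟩ := four_dvd_of_two_dvd_sq h2
      have h2 : (2 : ℤ) ∣ y + (p - 1) := by
        have := two_dvd_sub_of_sq (a := y) (b := -(p - 1))
          ⟨p * w, by linarith [congrArg (fun z => (p : ℤ) * z) hw]⟩
        rwa [sub_neg_eq_add] at this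
      obtain ⟨c, hc⟩ := hcop.mul_dvd h2 hd
      exact ⟨c, by linear_combination hc⟩
    have fin : ∀ x c : ℤ, (p : ℤ) * x ^ 2 + 2 * (2 * p * c - (p - 1)) ^ 2 =
        p * n ^ 2 + 2 * (p - 1) ^ 2 →
        (n : ℤ) ^ 2 = x ^ 2 + 2 * (2 : ℕ) *
          (c * ((((2 * p + 2 : ℕ) : ℤ) - 2) * c - (((2 * p + 2 : ℕ) : ℤ) - 4))) := by
      intro x c h
      have hp0 : (p : ℤ) ≠ 0 := by positivity
      apply mul_left_cancel₀ hp0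
      push_cast
      linear_combination -h
    intro h x y hxy
    have hdiv : (p : ℤ) ∣ (y + (p - 1)) * (-y + (p - 1)) := by
      refine hcop.symm.dvd_of_dvd_mul_left ⟨x ^ 2 - n ^ 2, by linear_combination -hxy⟩
    rcases (Nat.prime_iff_prime_int.1 hp).dvd_or_dvd hdiv with hd | hd
    · obtain ⟨c, rfl⟩ := key x y hxy hd
      exact h x c (Or.inl (by omega)) (fin x c hxy)
    · have hxy' : (p : ℤ) * x ^ 2 + 2 * (-y) ^ 2 = p * n ^ 2 + 2 * (p - 1) ^ 2 := by
        rw [neg_sq]; exact hxy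
      obtain ⟨c, hc⟩ := key x (-y) hxy' hd
      rw [hc] at hxy'
      exact h x c (Or.inl (by omega)) (fin x c hxy')
  · intro h x c _ hx
    refine h x (2 * p * c - (p - 1)) ?_
    push_cast at hx
    linear_combination -p * hx

/-- For odd n the identity (2k + 1)² = 1 + 4k(k + 1) is itself a representation as soon as k > 0. -/
theorem polyRepr_three_two_odd {k : ℕ} : polyRepr 3 2 (2 * k + 1) = 0 ↔ k = 0 := by
  rw [polyRepr_eq_zero_iff le_rfl]
  constructor
  · intro h
    by_contra hk
    have := h 1 k (Or.inr (by omega)) (by push_cast; ring)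
    push_cast at this
    have hk' : (0 : ℤ) < k := by omega
    nlinarith
  · rintro rfl x c hc hx
    have hc0 : 0 < c := hc.resolve_left (by norm_num)
    push_cast at hx
    nlinarith [sq_nonneg x]

theorem polyRepr_three_two_even {k : ℕ} :
    polyRepr 3 2 (2 * k) = 0 ↔ IsUniqueRep 4 1 k 1 := by
  rw [polyRepr_eq_zero_iff le_rfl]
  constructor
  · intro h x y hxy
    have hy : Odd y := by
      have h2 : (2 : ℤ) ∣ y ^ 2 - 1 ^ 2 := ⟨2 * k ^ 2 - 2 * x ^ 2, by linear_combination hxy⟩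
      have := two_dvd_sub_of_sq h2
      rw [Int.odd_iff]; omega
    obtain ⟨c, hc⟩ := hy.natAbs
    rw [← Int.natAbs_sq y, hc] at hxy
    push_cast at hxy
    rcases Nat.eq_zero_or_pos c with rfl | hc0
    · simpa using hxy
    · have := h (2 * x) c (Or.inr (by exact_mod_cast hc0)) (by push_cast; linarith)
      push_cast at this
      linarith
  · intro h x c _ hx
    push_cast at hx
    have h2 : (2 : ℤ) ∣ x := by
      have := two_dvd_sub_of_sq (a := x) (b := 2 * k)
        ⟨-2 * (c * (c + 1)), by linear_combination -hx⟩
      omega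
    obtain ⟨z, rfl⟩ := h2
    have := h z (2 * c + 1) (by linear_combination -hx)
    push_cast
    rw [mul_pow, mul_pow, this]

/-! ### Criteria in terms of multiples of primes -/

theorem isUniqueRep_one_iff {D n : ℕ} (hD : (D : ℤ) ∈ ({2, 4, 6, 10, 22, 58} : Finset ℤ))
    (hn : 0 < n) (f : ℕ) (hf : 0 < f) (hnf : n.Coprime f) (hDf : D.Coprime f) :
    IsUniqueRep D 1 n f ↔ (D * n ^ 2 + f ^ 2).Prime := by
  have hD2 := two_le_of_mem hD
  refine isUniqueRep_principal_iff hD (by push_cast; ring) (Nat.isCoprime_iff_coprime.2 hnf)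
    (Nat.isCoprime_iff_coprime.2 ?_) ?_
  · rw [add_comm, Nat.coprime_add_mul_left_left]
    exact (hDf.pow_right 2).symm
  · have : 0 < D * n ^ 2 := Nat.mul_pos (by omega) (by positivity)
    have : 0 < f ^ 2 := by positivity
    omega

/-- Each factor 3 shared by n and 3^j is cancelled and puts a factor 9 into N; once 3 ∤ n, N is
prime to 3 and only 9⁰ remains. -/
theorem isUniqueRep_three_pow {D : ℕ} (hD : (D : ℤ) ∈ ({2, 4, 6, 10, 22, 58} : Finset ℤ))
    (h3 : AnisotropicMod D 1 3) (hD3 : D.Coprime 3) (j : ℕ) : ∀ n : ℕ, 0 < n →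
    (IsUniqueRep D 1 n (3 ^ j) ↔ ∃ i ≤ j, D * n ^ 2 + 9 ^ j ∈ scaledPrimes (9 ^ i)) := by
  have base : ∀ n j : ℕ, 0 < n → n.Coprime (3 ^ j) →
      (IsUniqueRep D 1 n (3 ^ j) ↔ (D * n ^ 2 + 9 ^ j).Prime) := by
    intro n j hn hc
    have := isUniqueRep_one_iff hD hn (3 ^ j) (by positivity) hc (hD3.pow_right j)
    rw [← pow_mul, mul_comm j 2, pow_mul] at this
    exact_mod_cast this
  induction j with
  | zero =>
    intro n hn
    rw [base n 0 hn (by simp)]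
    simp [mem_scaledPrimes_one]
  | succ j ih =>
    intro n hn
    by_cases h : 3 ∣ n
    · obtain ⟨n, rfl⟩ := h
      have hn' : 0 < n := by omega
      have h1 : IsUniqueRep D 1 ((3 * n : ℕ) : ℤ) (3 ^ (j + 1)) ↔ IsUniqueRep D 1 n (3 ^ j) := by
        have := h3.isUniqueRep_mul_mul (n := n) (e := 3 ^ j) three_ne_zero
        rw [pow_succ']
        push_cast at this ⊢
        exact this
      rw [h1, ih n hn', show D * (3 * n) ^ 2 + 9 ^ (j + 1) = 9 * (D * n ^ 2 + 9 ^ j) by ring]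
      constructor
      · rintro ⟨i, hi, h⟩
        refine ⟨i + 1, by omega, ?_⟩
        rwa [pow_succ', mul_mem_scaledPrimes_mul (by norm_num)]
      · rintro ⟨i, hi, h⟩
        rcases i with _ | i
        · exact (sq_mul_notMem_scaledPrimes (q := 3) (by norm_num) (by simp) h).elim
        · rw [pow_succ', mul_mem_scaledPrimes_mul (by norm_num)] at h
          exact ⟨i, by omega, h⟩
    · have hnc : n.Coprime 3 := ((Nat.Prime.coprime_iff_not_dvd Nat.prime_three).2 h).symm
      rw [base n (j + 1) hn (hnc.pow_right _)]
      constructor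
      · exact fun hp => ⟨0, by omega, by simpa [mem_scaledPrimes_one] using hp⟩
      · rintro ⟨i, hi, hm⟩
        rcases i with _ | i
        · simpa [mem_scaledPrimes_one] using hm
        · exfalso
          have hd : 3 ∣ D * n ^ 2 + 9 ^ (j + 1) :=
            (Dvd.intro (3 * 9 ^ i) (by ring)).trans (dvd_of_mem_scaledPrimes hm)
          rw [show D * n ^ 2 + 9 ^ (j + 1) = 3 * (3 * 9 ^ j) + D * n ^ 2 by ring,
            Nat.dvd_add_right (dvd_mul_right _ _)] at hd
          exact h (Nat.prime_three.dvd_of_dvd_pow (hD3.symm.dvd_of_dvd_mul_left hd))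

/-- If p ∣ n, the ramified prime p is cancelled and the form becomes 2px² + y²; otherwise N is prime
to 2p. -/
theorem isUniqueRep_two_prime_iff {p n : ℕ} (hp : (p : ℤ) ∈ ({3, 5, 11, 29} : Finset ℤ))
    (hpp : p.Prime) (hn : 0 < n) :
    IsUniqueRep 2 p n 1 ↔
      2 * n ^ 2 + p ∈ scaledPrimes 1 ∨ 2 * n ^ 2 + p ∈ scaledPrimes p := by
  have hp3 : 3 ≤ p := by exact_mod_cast three_le_of_mem hp
  have hp2 : p.Coprime 2 := (Nat.coprime_primes hpp Nat.prime_two).2 (by omega)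
  by_cases h : p ∣ n
  · obtain ⟨n, rfl⟩ := h
    have hn' : 0 < n := Nat.pos_of_mul_pos_left hn
    have h1 : IsUniqueRep 2 p ((p * n : ℕ) : ℤ) 1 ↔ IsUniqueRep ((2 * p : ℕ) : ℤ) 1 n (1 : ℕ) := by
      have := isUniqueRep_mul_ramified (A := 2) (B := 1) (n := n) (e := 1)
        (Nat.prime_iff_prime_int.1 hpp) (fun h => by
          have := Int.le_of_dvd (by norm_num) h
          omega)
      rw [one_mul] at this
      push_cast
      exact this
    rw [h1, isUniqueRep_one_iff (by exact_mod_cast two_mul_mem hp) hn' 1 one_pos (by simp)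
      (by simp), show 2 * (p * n) ^ 2 + p = p * (2 * p * n ^ 2 + 1 ^ 2) by ring]
    have h2 : p * (2 * p * n ^ 2 + 1 ^ 2) ∈ scaledPrimes p ↔ (2 * p * n ^ 2 + 1 ^ 2).Prime := by
      have := mul_mem_scaledPrimes_mul (k := 1) (M := 2 * p * n ^ 2 + 1 ^ 2) hpp.pos
      rwa [mul_one, mem_scaledPrimes_one] at this
    rw [h2, mem_scaledPrimes_one, or_iff_right]
    refine Nat.not_prime_mul (by omega) ?_
    have : 0 < 2 * p * n ^ 2 := by positivity
    omega
  · have hc : (2 * n ^ 2 + p).Coprime p := by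
      rw [Nat.coprime_add_self_left]
      exact Nat.Coprime.mul_left hp2.symm
        (Nat.Coprime.pow_left 2 ((Nat.Prime.coprime_iff_not_dvd hpp).2 h).symm)
    have hc2 : (2 * n ^ 2 + p).Coprime 2 := by
      rw [add_comm, Nat.coprime_add_mul_left_left]; exact hp2
    rw [isUniqueRep_two_iff (N := 2 * n ^ 2 + p) hp (by push_cast; ring) isCoprime_one_right
      (by exact_mod_cast Nat.isCoprime_iff_coprime.2 (hc2.mul_right hc)) (by omega),
      mem_scaledPrimes_one, or_iff_left]
    intro hm
    have := Nat.eq_one_of_dvd_coprimes hc (dvd_of_mem_scaledPrimes hm) dvd_rfl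
    omega

/-- The unique-representation criterion for `p n ^ 2 + 2 (2 ^ j f) ^ 2` when `f` is odd and
coprime to `n`. -/
theorem isUniqueRep_two_pow {p f : ℕ} (hp : (p : ℤ) ∈ ({3, 5, 11, 29} : Finset ℤ))
    (hpp : p.Prime) (hf : Odd f) (hpf : p.Coprime f) (j : ℕ) : ∀ n : ℕ, 0 < n → n.Coprime f →
    (IsUniqueRep p 2 n ((2 ^ j * f : ℕ) : ℤ) ↔
      p * n ^ 2 + 2 * (2 ^ j * f) ^ 2 ∈ scaledPrimes (2 * 4 ^ j) ∨
      ∃ i ≤ j, p * n ^ 2 + 2 * (2 ^ j * f) ^ 2 ∈ scaledPrimes (4 ^ i)) := by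
  have hp3 : 3 ≤ p := by exact_mod_cast three_le_of_mem hp
  have hp2 : p.Coprime 2 := (Nat.coprime_primes hpp Nat.prime_two).2 (by omega)
  have hf0 : 0 < f := hf.pos
  -- For odd n the value N is odd, so only the scale 4⁰ can occur.
  have odd_case : ∀ n j : ℕ, Odd n → n.Coprime f →
      (IsUniqueRep p 2 n ((2 ^ j * f : ℕ) : ℤ) ↔
      p * n ^ 2 + 2 * (2 ^ j * f) ^ 2 ∈ scaledPrimes (2 * 4 ^ j) ∨
      ∃ i ≤ j, p * n ^ 2 + 2 * (2 ^ j * f) ^ 2 ∈ scaledPrimes (4 ^ i)) := by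
    intro n j hn hnf
    have hn2 : n.Coprime 2 := Nat.coprime_two_right.2 hn
    set N := p * n ^ 2 + 2 * (2 ^ j * f) ^ 2 with hN
    have hN2 : N.Coprime 2 := by
      rw [hN, Nat.coprime_add_mul_left_left]
      exact hp2.mul_left (hn2.pow_left 2)
    have hNp : N.Coprime p := by
      rw [hN, add_comm, Nat.coprime_add_mul_left_left]
      exact hp2.symm.mul_left (((hp2.symm.pow_left j).mul_left hpf.symm).pow_left 2)
    have hodd : ¬ 2 ∣ N := fun h => by
      have := Nat.eq_one_of_dvd_coprimes hN2 h dvd_rfl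
      omega
    have h1 : 1 < N := by
      have : 0 < p * n ^ 2 := Nat.mul_pos hpp.pos (pow_pos hn.pos 2)
      have : 0 < (2 ^ j * f) ^ 2 := by positivity
      omega
    have hcore := isUniqueRep_two_iff (N := N) (n := ((2 ^ j * f : ℕ) : ℤ)) (e := n) hp
      (by rw [hN]; push_cast; ring)
      (Nat.isCoprime_iff_coprime.2 (((hn2.pow_right j).mul_right hnf).symm))
      (by exact_mod_cast Nat.isCoprime_iff_coprime.2 (hN2.mul_right hNp)) h1
    rw [isUniqueRep_comm (by omega) (by norm_num), hcore]
    constructor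
    · exact fun h => Or.inr ⟨0, by omega, by simpa [mem_scaledPrimes_one] using h⟩
    · rintro (h | ⟨i, hi, h⟩)
      · exact (hodd ((dvd_mul_right _ _).trans (dvd_of_mem_scaledPrimes h))).elim
      · rcases i with _ | i
        · simpa [mem_scaledPrimes_one] using h
        · exact (hodd ((Dvd.intro (2 * 4 ^ i) (by ring)).trans (dvd_of_mem_scaledPrimes h))).elim
  induction j with
  | zero =>
    intro n hn hnf
    rcases Nat.even_or_odd' n with ⟨k, rfl | rfl⟩
    -- With j used up and n still even, the ramified prime 2 is cancelled once: the source of the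
    -- scale 2·4^j.
    · have hk : 0 < k := by omega
      have h1 : IsUniqueRep p 2 ((2 * k : ℕ) : ℤ) ((2 ^ 0 * f : ℕ) : ℤ) ↔
          IsUniqueRep ((2 * p : ℕ) : ℤ) 1 k f := by
        have := isUniqueRep_mul_ramified (A := p) (B := 1) (n := k) (e := f) Int.prime_two
          (fun h => by
            have := Nat.eq_one_of_dvd_coprimes hp2 (by exact_mod_cast h) dvd_rfl
            omega)
        rw [one_mul] at this
        push_cast
        rw [one_mul, mul_comm 2 (p : ℤ)]
        exact this
      rw [h1, isUniqueRep_one_iff (by exact_mod_cast two_mul_mem hp) hk f hf0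
        hnf.coprime_mul_left ((Nat.coprime_two_left.2 hf).mul_left hpf),
        show p * (2 * k) ^ 2 + 2 * (2 ^ 0 * f) ^ 2 = 2 * (2 * p * k ^ 2 + f ^ 2) by ring,
        pow_zero, mul_mem_scaledPrimes_mul two_pos, mem_scaledPrimes_one, or_iff_left]
      rintro ⟨i, hi, h⟩
      obtain rfl : i = 0 := by omega
      rw [pow_zero, mem_scaledPrimes_one] at h
      refine Nat.not_prime_mul (by norm_num) ?_ h
      have : 0 < 2 * p * k ^ 2 := by positivity
      have : 0 < f ^ 2 := by positivity
      omega
    · exact odd_case _ 0 (odd_two_mul_add_one k) hnf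
  | succ j ih =>
    intro n hn hnf
    rcases Nat.even_or_odd' n with ⟨k, rfl | rfl⟩
    · have hk : 0 < k := by omega
      have h1 : IsUniqueRep p 2 ((2 * k : ℕ) : ℤ) ((2 ^ (j + 1) * f : ℕ) : ℤ) ↔
          IsUniqueRep p 2 k ((2 ^ j * f : ℕ) : ℤ) := by
        rw [pow_succ', mul_assoc, Nat.cast_mul, Nat.cast_mul 2 (2 ^ j * f)]
        refine isUniqueRep_mul_mul (q := 2) two_ne_zero ?_
        rintro x y ⟨w, hw⟩
        have hpo : ¬ (2 : ℤ) ∣ p := fun h => by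
          have := Nat.eq_one_of_dvd_coprimes hp2 (by exact_mod_cast h) dvd_rfl
          omega
        have hx : (2 : ℤ) ∣ p * x ^ 2 := ⟨2 * w - y ^ 2, by linear_combination hw⟩
        obtain ⟨z, rfl⟩ := Int.prime_two.dvd_of_dvd_pow
          ((Int.prime_two.dvd_or_dvd hx).resolve_left hpo)
        exact ⟨dvd_mul_right _ _, Int.prime_two.dvd_of_dvd_pow (n := 2)
          ⟨w - p * z ^ 2, by linarith⟩⟩
      rw [h1, ih k hk hnf.coprime_mul_left, show p * (2 * k) ^ 2 + 2 * (2 ^ (j + 1) * f) ^ 2 =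
        4 * (p * k ^ 2 + 2 * (2 ^ j * f) ^ 2) by ring,
        show 2 * 4 ^ (j + 1) = 4 * (2 * 4 ^ j) by ring, mul_mem_scaledPrimes_mul (by norm_num)]
      refine or_congr_right ?_
      constructor
      · rintro ⟨i, hi, h⟩
        refine ⟨i + 1, by omega, ?_⟩
        rwa [pow_succ', mul_mem_scaledPrimes_mul (by norm_num)]
      · rintro ⟨i, hi, h⟩
        rcases i with _ | i
        · exact (sq_mul_notMem_scaledPrimes (q := 2) (by norm_num) (by simp) h).elim
        · rw [pow_succ', mul_mem_scaledPrimes_mul (by norm_num)] at h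
          exact ⟨i, by omega, h⟩
    · exact odd_case _ (j + 1) (odd_two_mul_add_one k) hnf

/-- The unique-representation criterion for `p n ^ 2 + 2 (2 ^ j q) ^ 2` when `p x ^ 2 + 2 y ^ 2`
is anisotropic modulo the odd prime `q`. -/
theorem isUniqueRep_two_pow_mul {p q : ℕ} (hp : (p : ℤ) ∈ ({3, 5, 11, 29} : Finset ℤ))
    (hpp : p.Prime) (hq : q.Prime) (hq2 : Odd q) (hpq : p.Coprime q)
    (ha : AnisotropicMod p 2 q) (j n : ℕ) (hn : 0 < n) :
    IsUniqueRep p 2 n ((2 ^ j * q : ℕ) : ℤ) ↔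
      ∃ k ∈ ({1, q ^ 2} : Finset ℕ),
        p * n ^ 2 + 2 * (2 ^ j * q) ^ 2 ∈ scaledPrimes (k * (2 * 4 ^ j)) ∨
        ∃ i ≤ j, p * n ^ 2 + 2 * (2 ^ j * q) ^ 2 ∈ scaledPrimes (k * 4 ^ i) := by
  have hq2' : q.Coprime 2 := Nat.coprime_two_right.2 hq2
  have hq4 : ∀ i, q.Coprime (4 ^ i) := fun i => by
    have := hq2'.pow_right (2 * i)
    rwa [pow_mul] at this
  by_cases h : q ∣ n
  · obtain ⟨n, rfl⟩ := h
    have hn' : 0 < n := Nat.pos_of_mul_pos_left hn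
    have h1 : IsUniqueRep p 2 ((q * n : ℕ) : ℤ) ((2 ^ j * q : ℕ) : ℤ) ↔
        IsUniqueRep p 2 n ((2 ^ j * 1 : ℕ) : ℤ) := by
      have := ha.isUniqueRep_mul_mul (n := n) (e := 2 ^ j) hq.ne_zero
      rw [mul_comm _ q, mul_one]
      push_cast
      exact this
    rw [h1, isUniqueRep_two_pow hp hpp odd_one (by simp) j n hn' (by simp),
      show p * (q * n) ^ 2 + 2 * (2 ^ j * q) ^ 2 = q ^ 2 * (p * n ^ 2 + 2 * (2 ^ j * 1) ^ 2) by
        ring]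
    simp only [Finset.mem_insert, Finset.mem_singleton, exists_eq_or_imp, exists_eq_left,
      mul_mem_scaledPrimes_mul (pow_pos hq.pos 2), one_mul]
    -- When q ∣ n, q² divides N, which rules out the scales prime to q.
    rw [or_iff_right (a := _ ∨ _)]
    rintro (h | ⟨i, -, h⟩)
    · exact sq_mul_notMem_scaledPrimes hq.one_lt (hq2'.mul_right (hq4 j)) h
    · exact sq_mul_notMem_scaledPrimes hq.one_lt (hq4 i) h
  · rw [isUniqueRep_two_pow hp hpp hq2 hpq j n hn
      ((Nat.Prime.coprime_iff_not_dvd hq).2 h).symm]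
    simp only [Finset.mem_insert, Finset.mem_singleton, exists_eq_or_imp, exists_eq_left, one_mul]
    have hN : ¬ q ∣ p * n ^ 2 + 2 * (2 ^ j * q) ^ 2 := by
      intro hd
      rw [show p * n ^ 2 + 2 * (2 ^ j * q) ^ 2 = q * (2 * 2 ^ j * 2 ^ j * q) + p * n ^ 2 by ring,
        Nat.dvd_add_right (dvd_mul_right _ _)] at hd
      exact h (hq.dvd_of_dvd_pow (hpq.symm.dvd_of_dvd_mul_left hd))
    have hq' : ∀ k, p * n ^ 2 + 2 * (2 ^ j * q) ^ 2 ∉ scaledPrimes (q ^ 2 * k) := fun k hk =>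
      hN (((dvd_pow_self q two_ne_zero).mul_right k).trans (dvd_of_mem_scaledPrimes hk))
    simp [hq']

/-! ### Assembling the fourteen cases -/

theorem polyRepr_three_pow_iff {m p n j : ℕ} (hp : (p : ℤ) ∈ ({3, 5, 11, 29} : Finset ℤ))
    (hpp : p.Prime) (hm : m = p + 2) (h3 : AnisotropicMod (2 * p : ℕ) 1 3) (hp3 : p.Coprime 3)
    (hj : (p : ℤ) - 2 = 3 ^ j) (hn : 0 < n) :
    polyRepr m 1 n = 0 ↔ ∃ i ≤ j, 2 * p * n ^ 2 + 9 ^ j ∈ scaledPrimes (9 ^ i) := by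
  have hp2 : p ≠ 2 := by have := three_le_of_mem hp; omega
  rw [polyRepr_one_iff hpp hp2 hm, hj]
  exact_mod_cast isUniqueRep_three_pow (by exact_mod_cast two_mul_mem hp) h3
    (Nat.Coprime.mul_left (by norm_num) hp3) j n hn

theorem polyRepr_two_pow_iff {m p n j : ℕ} (hp : (p : ℤ) ∈ ({3, 5, 11, 29} : Finset ℤ))
    (hpp : p.Prime) (hm : m = 2 * p + 2) (hj : (p : ℤ) - 1 = 2 ^ j) (hn : 0 < n) :
    polyRepr m 2 n = 0 ↔ p * n ^ 2 + 2 * (2 ^ j) ^ 2 ∈ scaledPrimes (2 * 4 ^ j) ∨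
      ∃ i ≤ j, p * n ^ 2 + 2 * (2 ^ j) ^ 2 ∈ scaledPrimes (4 ^ i) := by
  have hp2 : p ≠ 2 := by have := three_le_of_mem hp; omega
  rw [polyRepr_two_iff hpp hp2 hm, hj]
  simpa using isUniqueRep_two_pow hp hpp odd_one (by simp) j n hn (by simp)

theorem polyRepr_two_pow_mul_iff {m p q n j : ℕ} (hp : (p : ℤ) ∈ ({3, 5, 11, 29} : Finset ℤ))
    (hpp : p.Prime) (hq : q.Prime) (hq2 : Odd q) (hpq : p.Coprime q)
    (ha : AnisotropicMod p 2 q) (hm : m = 2 * p + 2) (hj : (p : ℤ) - 1 = 2 ^ j * q)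
    (hn : 0 < n) :
    polyRepr m 2 n = 0 ↔ ∃ k ∈ ({1, q ^ 2} : Finset ℕ),
        p * n ^ 2 + 2 * (2 ^ j * q) ^ 2 ∈ scaledPrimes (k * (2 * 4 ^ j)) ∨
        ∃ i ≤ j, p * n ^ 2 + 2 * (2 ^ j * q) ^ 2 ∈ scaledPrimes (k * 4 ^ i) := by
  have hp2 : p ≠ 2 := by have := three_le_of_mem hp; omega
  rw [polyRepr_two_iff hpp hp2 hm, hj]
  exact_mod_cast isUniqueRep_two_pow_mul hp hpp hq hq2 hpq ha j n hn

theorem polyRepr_three_prime_iff {p n : ℕ} (hp : (p : ℤ) ∈ ({3, 5, 11, 29} : Finset ℤ))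
    (hpp : p.Prime) (hn : 0 < n) :
    polyRepr 3 p n = 0 ↔ 2 * n ^ 2 + p ∈ primeSet ∪ scaledPrimes p := by
  have hp2 : p ≠ 2 := by have := three_le_of_mem hp; omega
  rw [polyRepr_three_iff (hpp.odd_of_ne_two hp2), isUniqueRep_two_prime_iff hp hpp hn,
    Set.mem_union, mem_primeSet_iff]

theorem polyRepr_three_one_iff {n : ℕ} (hn : 0 < n) :
    polyRepr 3 1 n = 0 ↔ 2 * n ^ 2 + 1 ∈ primeSet := by
  rw [polyRepr_three_iff odd_one]
  exact isUniqueRep_one_iff (D := 2) (by decide) hn 1 one_pos (by simp) (by simp)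

theorem polyRepr_three_two_iff {n : ℕ} (hn : 0 < n) :
    polyRepr 3 2 n = 0 ↔ n ^ 2 + 1 ∈ primeSet := by
  rcases Nat.even_or_odd' n with ⟨k, rfl | rfl⟩
  · rw [polyRepr_three_two_even, show (2 * k) ^ 2 + 1 = 4 * k ^ 2 + 1 ^ 2 by ring]
    exact isUniqueRep_one_iff (D := 4) (by decide) (by omega) 1 one_pos (by simp) (by simp)
  · rw [polyRepr_three_two_odd, show (2 * k + 1) ^ 2 + 1 = 2 * (2 * (k ^ 2 + k) + 1) by ring]
    constructor
    · rintro rfl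
      exact Nat.prime_two
    · intro h
      by_contra hk
      have : 0 < k ^ 2 := by positivity
      exact Nat.not_prime_mul (by norm_num) (by omega) h

theorem exists_le_succ {P : ℕ → Prop} {j : ℕ} :
    (∃ i ≤ j + 1, P i) ↔ (∃ i ≤ j, P i) ∨ P (j + 1) := by
  constructor
  · rintro ⟨i, hi, h⟩
    rcases Nat.le_succ_iff.1 hi with h' | rfl
    · exact Or.inl ⟨i, h', h⟩
    · exact Or.inr h
  · rintro (⟨i, hi, h⟩ | h)
    · exact ⟨i, by omega, h⟩
    · exact ⟨_, le_rfl, h⟩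

theorem corollary1 (n : ℕ) (hn : 0 < n) :
    (polyRepr 3 1 n = 0 ↔
      2 * n ^ 2 + 1 ∈ primeSet) ∧
    (polyRepr 5 1 n = 0 ↔
      6 * n ^ 2 + 1 ∈ primeSet) ∧
    (polyRepr 7 1 n = 0 ↔
      10 * n ^ 2 + 9 ∈ primeSet ∪ scaledPrimes 9) ∧
    (polyRepr 13 1 n = 0 ↔
      22 * n ^ 2 + 81 ∈ primeSet ∪ scaledPrimes 9 ∪ scaledPrimes 81) ∧
    (polyRepr 31 1 n = 0 ↔
      58 * n ^ 2 + 729 ∈ primeSet ∪ scaledPrimes 9 ∪ scaledPrimes 81 ∪ scaledPrimes 729) ∧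
    (polyRepr 3 2 n = 0 ↔
      n ^ 2 + 1 ∈ primeSet) ∧
    (polyRepr 8 2 n = 0 ↔
      3 * n ^ 2 + 8 ∈ primeSet ∪ scaledPrimes 4 ∪ scaledPrimes 8) ∧
    (polyRepr 12 2 n = 0 ↔
      5 * n ^ 2 + 32 ∈ primeSet ∪ scaledPrimes 4 ∪ scaledPrimes 16 ∪ scaledPrimes 32) ∧
    (polyRepr 24 2 n = 0 ↔
      11 * n ^ 2 + 200 ∈ primeSet ∪ scaledPrimes 4 ∪ scaledPrimes 8 ∪ scaledPrimes 25 ∪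
        scaledPrimes 100 ∪ scaledPrimes 200) ∧
    (polyRepr 60 2 n = 0 ↔
      29 * n ^ 2 + 1568 ∈ primeSet ∪ scaledPrimes 4 ∪ scaledPrimes 16 ∪ scaledPrimes 32 ∪
        scaledPrimes 49 ∪ scaledPrimes 196 ∪ scaledPrimes 784 ∪ scaledPrimes 1568) ∧
    (polyRepr 3 3 n = 0 ↔
      2 * n ^ 2 + 3 ∈ primeSet ∪ scaledPrimes 3) ∧
    (polyRepr 3 5 n = 0 ↔
      2 * n ^ 2 + 5 ∈ primeSet ∪ scaledPrimes 5) ∧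
    (polyRepr 3 11 n = 0 ↔
      2 * n ^ 2 + 11 ∈ primeSet ∪ scaledPrimes 11) ∧
    (polyRepr 3 29 n = 0 ↔
      2 * n ^ 2 + 29 ∈ primeSet ∪ scaledPrimes 29) := by
  have h5 : Nat.Prime 5 := by norm_num
  have h11 : Nat.Prime 11 := by norm_num
  have h29 : Nat.Prime 29 := by norm_num
  refine ⟨polyRepr_three_one_iff hn, ?_, ?_, ?_, ?_, polyRepr_three_two_iff hn, ?_, ?_, ?_, ?_,
    polyRepr_three_prime_iff (by decide) Nat.prime_three hn,
    polyRepr_three_prime_iff (by decide) h5 hn, polyRepr_three_prime_iff (by decide) h11 hn,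
    polyRepr_three_prime_iff (by decide) h29 hn⟩
  · rw [polyRepr_one_iff Nat.prime_three (by norm_num) rfl]
    exact isUniqueRep_one_iff (D := 6) (by decide) hn 1 one_pos (by simp) (by simp)
  -- For t = 1 and m > 3, p = m - 2 and p - 2 = 3^j.
  · rw [polyRepr_three_pow_iff (p := 5) (j := 1) (by decide) h5 rfl
      (anisotropicMod_of_zmod (by decide)) (by norm_num) (by norm_num) hn]
    simp [exists_le_succ, mem_primeSet_iff]
  · rw [polyRepr_three_pow_iff (p := 11) (j := 2) (by decide) h11 rfl
      (anisotropicMod_of_zmod (by decide)) (by norm_num) (by norm_num) hn]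
    simp [exists_le_succ, mem_primeSet_iff]
  · rw [polyRepr_three_pow_iff (p := 29) (j := 3) (by decide) h29 rfl
      (anisotropicMod_of_zmod (by decide)) (by norm_num) (by norm_num) hn]
    simp [exists_le_succ, mem_primeSet_iff]
  · rw [polyRepr_two_pow_iff (p := 3) (j := 1) (by decide) Nat.prime_three rfl (by norm_num) hn]
    simp [exists_le_succ, mem_primeSet_iff]
    tauto
  · rw [polyRepr_two_pow_iff (p := 5) (j := 2) (by decide) h5 rfl (by norm_num) hn]
    simp [exists_le_succ, mem_primeSet_iff]
    tauto
  -- Here p - 1 = 2^j q with q = 5, and q = 7 in the next case; the odd prime q doubles the list of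
  -- scales.
  · rw [polyRepr_two_pow_mul_iff (p := 11) (q := 5) (j := 1) (by decide) h11 h5 (by decide)
      (by norm_num) (anisotropicMod_of_zmod (by decide)) rfl (by norm_num) hn]
    simp [exists_le_succ, mem_primeSet_iff]
    tauto
  · rw [polyRepr_two_pow_mul_iff (p := 29) (q := 7) (j := 2) (by decide) h29 (by norm_num)
      (by decide) (by norm_num) (anisotropicMod_of_zmod (by decide)) rfl (by norm_num) hn]
    simp [exists_le_succ, mem_primeSet_iff]
    tauto
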